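/- Let $\mathfrak R^n$ be the family of compact $\Omega\subset\mathbb R^n$ with $\Omega=\overline{\Omega^\circ}$ whose interior $\Omega^\circ$ is connected and contains $0$. Consider the constrained control system $$\dot x = A_s x + B_s u + e_s\quad (x\in\mathcal R_s),\qquad x\in\mathcal X\in\mathfrak R^n,\quad u\in\mathcal U=\{u\in\mathbb R^m: Hu\le h_c\}\in\mathfrak R^m,$$ where the closed sets $\mathcal R_1,\dots,\mathcal R_M$ have pairwise disjoint interiors and cover $\Omega\in\mathfrak R^n$, $\Omega\subseteq\mathcal X$, and $e_s=0$ whenever $0\in\mathcal R_s$. Let $\mathcal T=\{\sigma_i\}$, $\sigma_i=\mathrm{co}\{x_{i,0},\dots,x_{i,n}\}$, be a triangulation of $\Omega$ into finitely many $n$-simplexes, any two of which meet in a common face or not at all, with $x_{i,0}=0$ whenever $0\in\sigma_i$, such that every $\mathcal R_s$ is a union of simplexes of $\mathcal T$; each simplex is assigned to one region. Let $\mathbb E$ be its vertex set. For $\mathbf V=\{V_x\}_{x\in\mathbb E}\subset\mathbb R$, $\mathbf U=\{u_x\}_{x\in\mathbb E}\subset\mathbb R^m$, let $V,u$ be the continuous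 functions on $\mathcal T$ that are affine on each simplex (CPA) and have these vertex values, and let $\nabla V_i$ be the gradient of $V$ on $\sigma_i$. For a cost function $J$, let $y^*=(\mathbf V^*,\mathbf U^*,a^*,b_1^*,b_2^*)$ minimize $J$ subject to \begin{align*} &V_0=0,\quad a\ge1,\quad b_1>0,\quad u_0=0;\\ &b_1\|x\|^a\le V_x,\quad Hu_x\le h_c\quad\text{for all } x\in\mathbb E\setminus\{0\};\\ &(A_sx_{i,j}+e_s)^{\mathsf T}\nabla V_i+u_{x_{i,j}}^{\mathsf T}B_s^{\mathsf T}\nabla V_i\le -b_2V_{x_{i,j}}\quad\text{for all } i,j, \end{align*} where $s$ is the region of $\sigma_i$. Suppose that $b_2^*>0$, and let $V^*,u^*$ be the CPA functions of $\mathbf V^*,\mathbf U^*$. A solution of the closed loop $\dot x=A_sx+B_su^*(x)+e_s$ on $[t_0,t_1]$ means an absolutely continuous $x:[t_0,t_1]\to\mathcal T$ that satisfies, for almost every $t$, this equation for some $s$ with $x(t)\in\mathcal R_s$. Then: 1. $u^*(x)\in\mathcal U$ for all $x\in\mathcal T$, and $V^*$ is a Lyapunov function of the closed loop on $\mathcal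 T$: it is continuous, $V^*(0)=0$, $V^*(x)\ge b_1^*\|x\|^{a^*}$ (so $V^*>0$ off $0$), and along every solution the upper right Dini derivative of $t\mapsto V^*(x(t))$ is at most $-b_2^*V^*(x(t))$. 2. $x=0$ is a locally exponentially stable equilibrium: there are $\delta,C,k>0$ such that $\|x(t)\|\le C\|x(t_0)\|e^{-k(t-t_0)}$ for every solution with $\|x(t_0)\|<\delta$. 3. Let $r>0$ be such that $\mathcal A=V^{*-1}([0,r])\subseteq\mathcal T$ belongs to $\mathfrak R^n$. Every solution with $x(t_0)\in\mathcal A^\circ$ stays in $\mathcal A$ and satisfies $$\|x(t)\|\le (r/b_1^*)^{1/a^*}e^{-(b_2^*/a^*)(t-t_0)}.$$ 4. Suppose moreover that the closed-loop vector field is single-valued (equivalently, continuous) on $\mathcal T$, i.e. that at each $x\in\mathcal T$ all $s$ with $x\in\mathcal R_s$ give the same value of $A_sx+B_su^*(x)+e_s=:g(x)$. Then $D^+V^*(x)=\limsup_{h\to0^+}(V^*(x+hg(x))-V^*(x))/h\le -b_2^*V^*(x)$ for all $x\in\mathcal T^\circ$; from every point of a neighbourhood of $0$ there is a solution on $[t_0,\infty)$;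 and if $\mathcal A$ is as in 3 and $V^*\ge r$ on $\partial\mathcal T$, then from every point of $\mathcal A^\circ$ there is a solution on $[t_0,\infty)$, with values in $\mathcal A$. -/

import Mathlib

open Set Filter Topology MeasureTheory
open scoped RealInnerProductSpace

noncomputable section

namespace PWA

/-- The state and input spaces, `ℝⁿ` with the Euclidean norm. -/
abbrev E (n : ℕ) : Type := EuclideanSpace ℝ (Fin n)

/-- The family of all compact `Ω ⊆ ℝⁿ` whose interior is connected and contains the origin, and
which are the closure of their interior. -/
def RegularSets (n : ℕ) : Set (Set (E n)) :=
  {Ω | IsCompact Ω ∧ IsConnected (interior Ω) ∧ (0 : E n) ∈ interior Ω ∧ closure (interior Ω) = Ω}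

/-- A triangulation: finitely many distinct `n`-simplexes `σ_i = co {x_{i,0}, …, x_{i,n}}`, any two
of which meet in a common face (the hull of their common vertices) or not at all, and whose union
belongs to `RegularSets n`.  In a simplex that contains the origin, the vertex number `0` is the
origin. -/
structure Triangulation (n : ℕ) where
  /-- the number of simplexes -/
  card : ℕ
  /-- `vertex i j` is the vertex `x_{i,j}` -/
  vertex : Fin card → Fin (n + 1) → E n
  affineIndependent : ∀ i, AffineIndependent ℝ (vertex i)
  simplex_injective : ∀ i k,
    convexHull ℝ (range (vertex i)) = convexHull ℝ (range (vertex k)) → i = k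
  inter_face : ∀ i k,
    convexHull ℝ (range (vertex i)) ∩ convexHull ℝ (range (vertex k)) =
      convexHull ℝ (range (vertex i) ∩ range (vertex k))
  vertex_zero : ∀ i, (0 : E n) ∈ convexHull ℝ (range (vertex i)) → vertex i 0 = 0
  regular : (⋃ i, convexHull ℝ (range (vertex i))) ∈ RegularSets n

namespace Triangulation

variable {n : ℕ} (T : Triangulation n)

/-- The simplex `σ_i`. -/
def simplex (i : Fin T.card) : Set (E n) := convexHull ℝ (range (T.vertex i))

/-- The set of points covered by the triangulation. -/
def support : Set (E n) := ⋃ i, T.simplex i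

/-- The set of all vertices of the triangulation. -/
def vertices : Set (E n) := {x | ∃ i j, T.vertex i j = x}

/-- The vertex `x_{i,j}` as an element of the vertex set. -/
def vtx (i : Fin T.card) (j : Fin (n + 1)) : T.vertices := ⟨T.vertex i j, i, j, rfl⟩

theorem zero_mem_vertices : (0 : E n) ∈ T.vertices := by
  have h := interior_subset T.regular.2.2.1
  obtain ⟨i, hi⟩ := mem_iUnion.1 h
  exact ⟨i, 0, T.vertex_zero i hi⟩

/-- The origin as an element of the vertex set. -/
def origin : T.vertices := ⟨0, T.zero_mem_vertices⟩

/-- The matrix `X_i` whose `j`-th row is `x_{i,j} - x_{i,0}`, for `j = 1, …, n`. -/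
def edgeMatrix (i : Fin T.card) : Matrix (Fin n) (Fin n) ℝ :=
  Matrix.of fun j k => (T.vertex i j.succ - T.vertex i 0) k

/-- The gradient `∇W_i = X_i⁻¹ W̄_i` on `σ_i` of the function with vertex values `W`, where the
`j`-th entry of `W̄_i` is `W (x_{i,j}) - W (x_{i,0})`. -/
def grad (W : T.vertices → ℝ) (i : Fin T.card) : E n :=
  WithLp.toLp 2 ((T.edgeMatrix i)⁻¹.mulVec fun j => W (T.vtx i j.succ) - W (T.vtx i 0))

open Classical in
/-- The continuous piecewise affine (CPA) interpolation on `T` of the vertex values `W`: on a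
simplex `σ_i` it is the affine function with gradient `∇W_i` and value `W (x_{i,0})` at `x_{i,0}`.
(On a common face the affine functions agree; the value `0` off `T` is immaterial.) -/
def cpa (W : T.vertices → ℝ) (x : E n) : ℝ :=
  if h : ∃ i, x ∈ T.simplex i then
    W (T.vtx h.choose 0) + ⟪T.grad W h.choose, x - T.vertex h.choose 0⟫
  else 0

/-- The CPA interpolation of vector values, componentwise. -/
def cpaVec {m : ℕ} (U : T.vertices → E m) (x : E n) : E m :=
  WithLp.toLp 2 fun k => T.cpa (fun v => U v k) x

end Triangulation

/-- The data of a piecewise affine control system `ẋ = A_s x + B_s u + e_s` for `x ∈ R_s`,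
with `M` regions, state dimension `n` and input dimension `m`. -/
structure System (n m M : ℕ) where
  /-- the regions -/
  R : Fin M → Set (E n)
  A : Fin M → Matrix (Fin n) (Fin n) ℝ
  B : Fin M → Matrix (Fin n) (Fin m) ℝ
  e : Fin M → E n

namespace System

variable {n m M : ℕ} (S : System n m M)

/-- The input part `B_s u`. -/
def inputTerm (s : Fin M) (u : E m) : E n := (S.B s).toEuclideanLin u

/-- The drift part `A_s x + e_s`. -/
def drift (s : Fin M) (x : E n) : E n := (S.A s).toEuclideanLin x + S.e s

/-- The right-hand side of the closed loop under the feedback `u`, as the set of all velocities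
`A_s x + B_s u(x) + e_s` of the regions `R_s` that contain `x`.  Off the switching surfaces this is
one vector. -/
def closedLoop (u : E n → E m) (x : E n) : Set (E n) :=
  {v | ∃ s, x ∈ S.R s ∧ v = S.drift s x + S.inputTerm s (u x)}

/-- The (closed) regions partition `Ω`: they cover it, with pairwise disjoint interiors. -/
def IsPartition (Ω : Set (E n)) : Prop :=
  (⋃ s, S.R s) = Ω ∧ ∀ s s', s ≠ s' → Disjoint (interior (S.R s)) (interior (S.R s'))

/-- `T` is comprised of triangulations of the regions: every region `R_s` is the union of the
simplexes `σ_i` of `T` with `mode i = s`. -/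
def Respects (T : Triangulation n) (mode : Fin T.card → Fin M) : Prop :=
  ∀ s, S.R s = ⋃ (i : Fin T.card) (_ : mode i = s), T.simplex i

end System

/-- The polytope `{u | H u ≤ h_c}`. -/
def polytope {m p : ℕ} (H : Matrix (Fin p) (Fin m) ℝ) (hc : Fin p → ℝ) : Set (E m) :=
  {u | ∀ l, H.mulVec u.ofLp l ≤ hc l}

/-- The unknowns `y = [V, U, a, b₁, b₂]` of the program. -/
structure Unknowns {n : ℕ} (T : Triangulation n) (m : ℕ) where
  V : T.vertices → ℝ
  U : T.vertices → E m
  a : ℝ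
  b₁ : ℝ
  b₂ : ℝ

/-- The number `D⁺_{i,j} V = (A_s x_{i,j} + e_s)ᵀ ∇V_i + u_{x_{i,j}}ᵀ B_sᵀ ∇V_i`, where `s` is the
region of `σ_i`. -/
def vertexDeriv {n m M : ℕ} (S : System n m M) (T : Triangulation n)
    (mode : Fin T.card → Fin M) (y : Unknowns T m) (i : Fin T.card) (j : Fin (n + 1)) : ℝ :=
  ⟪S.drift (mode i) (T.vertex i j), T.grad y.V i⟫ +
    ⟪S.inputTerm (mode i) (y.U (T.vtx i j)), T.grad y.V i⟫

/-- The constraints of the program. -/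
structure Feasible {n m M p : ℕ} (S : System n m M) (T : Triangulation n)
    (mode : Fin T.card → Fin M) (H : Matrix (Fin p) (Fin m) ℝ) (hc : Fin p → ℝ)
    (y : Unknowns T m) : Prop where
  V_zero : y.V T.origin = 0
  one_le_a : 1 ≤ y.a
  b₁_pos : 0 < y.b₁
  lower : ∀ x : T.vertices, x ≠ T.origin → y.b₁ * ‖(x : E n)‖ ^ y.a ≤ y.V x
  U_zero : y.U T.origin = 0
  input : ∀ x : T.vertices, x ≠ T.origin → y.U x ∈ polytope H hc
  decrease : ∀ i j, vertexDeriv S T mode y i j ≤ -(y.b₂ * y.V (T.vtx i j))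

/-- `y` is an optimum of the program with cost function `J`. -/
def IsOptimum {n m M p : ℕ} (S : System n m M) (T : Triangulation n)
    (mode : Fin T.card → Fin M) (H : Matrix (Fin p) (Fin m) ℝ) (hc : Fin p → ℝ)
    (J : Unknowns T m → ℝ) (y : Unknowns T m) : Prop :=
  Feasible S T mode H hc y ∧ ∀ z, Feasible S T mode H hc z → J y ≤ J z

/-- `φ` is a (Carathéodory) solution of `φ' ∈ F(φ)` on `[t₀, t₁]` with values in `D`. -/
structure IsSolutionOn {n : ℕ} (F : E n → Set (E n)) (D : Set (E n)) (φ : ℝ → E n)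
    (t₀ t₁ : ℝ) : Prop where
  le : t₀ ≤ t₁
  mem : ∀ t ∈ Icc t₀ t₁, φ t ∈ D
  absCont : AbsolutelyContinuousOnInterval φ t₀ t₁
  deriv : ∀ᵐ t, t ∈ Ioo t₀ t₁ → ∃ v ∈ F (φ t), HasDerivAt φ v t

/-- The upper right Dini derivative `limsup_{h → 0⁺} (g h - g 0) / h`. -/
def upperDini (g : ℝ → ℝ) : EReal :=
  limsup (fun h : ℝ => (((g h - g 0) / h : ℝ) : EReal)) (𝓝[>] 0)

/-- `V` is a Lyapunov function on `D` of `x' ∈ F(x)`: continuous, zero at the origin, positive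
elsewhere, and with negative Dini derivative along every solution away from the origin. -/
structure IsLyapunovFunction {n : ℕ} (F : E n → Set (E n)) (D : Set (E n)) (V : E n → ℝ) :
    Prop where
  zero_mem : (0 : E n) ∈ interior D
  continuousOn : ContinuousOn V D
  map_zero : V 0 = 0
  pos : ∀ x ∈ D, x ≠ 0 → 0 < V x
  decrease : ∀ φ t₀ t₁, IsSolutionOn F D φ t₀ t₁ → ∀ t ∈ Ico t₀ t₁, φ t ≠ 0 →
    upperDini (fun h => V (φ (t + h))) < 0

/-- The origin is a locally exponentially stable equilibrium of `x' ∈ F(x)` on `D`. -/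
def IsLocallyExponentiallyStable {n : ℕ} (F : E n → Set (E n)) (D : Set (E n)) : Prop :=
  F 0 = {0} ∧ ∃ δ C k : ℝ, 0 < δ ∧ 0 < C ∧ 0 < k ∧ Metric.ball 0 δ ⊆ D ∧
    ∀ φ t₀ t₁, IsSolutionOn F D φ t₀ t₁ → ‖φ t₀‖ < δ →
      ∀ t ∈ Icc t₀ t₁, ‖φ t‖ ≤ C * ‖φ t₀‖ * Real.exp (-k * (t - t₀))

/-- From `x₀` at time `t₀` there starts a solution of `x' ∈ F(x)` that is defined on `[t₀, ∞)` and
stays in `D`. -/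
def HasGlobalSolution {n : ℕ} (F : E n → Set (E n)) (D : Set (E n)) (t₀ : ℝ) (x₀ : E n) : Prop :=
  ∃ φ : ℝ → E n, φ t₀ = x₀ ∧ ∀ t₁, t₀ ≤ t₁ → IsSolutionOn F D φ t₀ t₁

end PWA

end

namespace PWA

open scoped NNReal

/-! On a single simplex the closed loop is an affine field (`velocity`) and `V` is affine with
constant gradient. The decrease condition therefore compares two affine functions of `x`, and
holding at the vertices it holds on the whole simplex (`Feasible.inner_grad_velocity_le`). The lower
bound spreads from the vertices because `‖x‖ ^ a` is convex for `a ≥ 1`, the input constraint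
because the polytope is convex.

The delicate point is decay along a solution `φ`, which may switch simplexes infinitely often or run
along faces, where `V` need not be differentiable. Velocities are bounded, so `φ` and `V ∘ φ` are
Lipschitz. For almost every `t` the velocity is that of a simplex `σ_i` containing `φ t`, and `φ` is
in `σ_i` at times after `t` arbitrarily close to `t`. Slopes of `V ∘ φ` along these times identify
its derivative as the one computed with `∇V_i` (`ae_deriv_cpa_comp_le`). Integration turns the
almost-everywhere bound into a Dini bound at every time, and Gronwall gives exponential decay of `V`
(`cpa_comp_le_mul_exp`). The bound `b₁ ‖x‖ ^ a ≤ V` then yields the sublevel estimate, and the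
linear bounds `c ‖x‖ ≤ V` on `T` and `V ≤ L ‖x‖` near `0` yield exponential stability.

A single-valued field is Lipschitz on convex subsets of `T`. Picard-Lindelöf thus gives a uniform
time step from any sublevel set inside the interior of `T`; decay of `V` keeps the solution in that
set, so the steps can be concatenated (`hasGlobalSolution_sublevel`). -/

theorem mul_add_mul_add_eq {n : ℕ} (g p x y : E n) (w : ℝ) {a b : ℝ} (hab : a + b = 1) :
    w + ⟪g, a • x + b • y - p⟫ = a * (w + ⟪g, x - p⟫) + b * (w + ⟪g, y - p⟫) := by
  have hb : b = 1 - a := by linarith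
  subst hb
  simp only [inner_sub_right, inner_add_right, inner_smul_right]
  ring

/-! ### Affine functions on simplexes and CPA interpolation -/

namespace Triangulation

variable {n : ℕ} (T : Triangulation n)

/-- The affine function on the whole space that has the vertex values `W` on the simplex `i`. -/
noncomputable def affOn (W : T.vertices → ℝ) (i : Fin T.card) (x : E n) : ℝ :=
  W (T.vtx i 0) + ⟪T.grad W i, x - T.vertex i 0⟫

theorem affOn_combo (W : T.vertices → ℝ) (i : Fin T.card) (x y : E n) {a b : ℝ}
    (hab : a + b = 1) :
    T.affOn W i (a • x + b • y) = a * T.affOn W i x + b * T.affOn W i y :=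
  mul_add_mul_add_eq _ _ _ _ _ hab

theorem affOn_sub (W : T.vertices → ℝ) (i : Fin T.card) (x y : E n) :
    T.affOn W i x - T.affOn W i y = ⟪T.grad W i, x - y⟫ := by
  simp only [affOn, inner_sub_right]
  ring

/-- The rows are the edges out of vertex `0`, which affine independence makes linearly independent.
Hence the inverse in `grad` is a genuine one. -/
theorem isUnit_edgeMatrix (i : Fin T.card) : IsUnit (T.edgeMatrix i) := by
  rw [← Matrix.linearIndependent_rows_iff_isUnit]
  have h := (affineIndependent_iff_linearIndependent_vsub ℝ _ 0).1 (T.affineIndependent i)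
  have h2 := h.comp (fun j : Fin n => (⟨j.succ, Fin.succ_ne_zero j⟩ : {x : Fin (n + 1) // x ≠ 0}))
    (fun a b hab => by simpa using hab)
  have h3 := h2.map' (WithLp.linearEquiv 2 ℝ (Fin n → ℝ)).toLinearMap (LinearEquiv.ker _)
  exact h3

theorem affOn_vertex (W : T.vertices → ℝ) (i : Fin T.card) (j : Fin (n + 1)) :
    T.affOn W i (T.vertex i j) = W (T.vtx i j) := by
  refine Fin.cases ?_ (fun k => ?_) j
  · simp [affOn]
  · have hu := (Matrix.isUnit_iff_isUnit_det _).1 (T.isUnit_edgeMatrix i)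
    have h : (T.edgeMatrix i).mulVec (T.grad W i).ofLp =
        fun j => W (T.vtx i j.succ) - W (T.vtx i 0) := by
      simp only [grad]
      rw [Matrix.mulVec_mulVec, Matrix.mul_nonsing_inv _ hu, Matrix.one_mulVec]
    have hk := congrFun h k
    have : ⟪T.grad W i, T.vertex i k.succ - T.vertex i 0⟫ =
        (T.edgeMatrix i).mulVec (T.grad W i).ofLp k := by
      simp [PiLp.inner_apply, Matrix.mulVec, dotProduct, edgeMatrix]
    rw [affOn, this, hk]
    ring

theorem simplex_subset_of_convex {i : Fin T.card} {C : Set (E n)} (hC : Convex ℝ C)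
    (h : ∀ j, T.vertex i j ∈ C) : T.simplex i ⊆ C :=
  convexHull_min (range_subset_iff.2 h) hC

/-- By the face condition the intersection of two simplexes is the hull of their common vertices,
where both affine functions take the prescribed values. This makes the choice of simplex in `cpa`
irrelevant. -/
theorem affOn_eq_affOn (W : T.vertices → ℝ) {i k : Fin T.card} {x : E n} (hi : x ∈ T.simplex i)
    (hk : x ∈ T.simplex k) : T.affOn W i x = T.affOn W k x := by
  have hx : x ∈ convexHull ℝ (range (T.vertex i) ∩ range (T.vertex k)) := by
    rw [← T.inter_face]
    exact ⟨hi, hk⟩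
  refine convexHull_min (t := {z | T.affOn W i z = T.affOn W k z}) ?_ ?_ hx
  · rintro _ ⟨⟨j, rfl⟩, ⟨l, hl⟩⟩
    have hv : T.vtx k l = T.vtx i j := Subtype.ext hl
    rw [mem_ofPred_eq, affOn_vertex, ← hl, affOn_vertex, hv]
  · intro y hy z hz a b _ _ hab
    simp only [mem_ofPred_eq] at hy hz ⊢
    rw [affOn_combo _ _ _ _ _ hab, affOn_combo _ _ _ _ _ hab, hy, hz]

theorem cpa_eq (W : T.vertices → ℝ) {i : Fin T.card} {x : E n} (hx : x ∈ T.simplex i) :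
    T.cpa W x = T.affOn W i x := by
  have h : ∃ i, x ∈ T.simplex i := ⟨i, hx⟩
  rw [cpa, dif_pos h]
  exact T.affOn_eq_affOn W h.choose_spec hx

/-- The affine map that has the vector vertex values `U` on the simplex `i`. -/
noncomputable def affVec {m : ℕ} (U : T.vertices → E m) (i : Fin T.card) (x : E n) : E m :=
  WithLp.toLp 2 fun k => T.affOn (fun v => U v k) i x

theorem cpaVec_eq {m : ℕ} (U : T.vertices → E m) {i : Fin T.card} {x : E n}
    (hx : x ∈ T.simplex i) : T.cpaVec U x = T.affVec U i x := by
  ext k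
  exact T.cpa_eq (fun v => U v k) hx

theorem affVec_combo {m : ℕ} (U : T.vertices → E m) (i : Fin T.card) (x y : E n) {a b : ℝ}
    (hab : a + b = 1) :
    T.affVec U i (a • x + b • y) = a • T.affVec U i x + b • T.affVec U i y := by
  ext k
  exact T.affOn_combo (fun v => U v k) i x y hab

theorem affVec_vertex {m : ℕ} (U : T.vertices → E m) (i : Fin T.card) (j : Fin (n + 1)) :
    T.affVec U i (T.vertex i j) = U (T.vtx i j) := by
  ext k
  exact T.affOn_vertex (fun v => U v k) i j

theorem mem_support {x : E n} : x ∈ T.support ↔ ∃ i, x ∈ T.simplex i := mem_iUnion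

theorem isCompact_simplex (i : Fin T.card) : IsCompact (T.simplex i) :=
  (finite_range _).isCompact_convexHull ℝ

theorem isClosed_simplex (i : Fin T.card) : IsClosed (T.simplex i) :=
  (T.isCompact_simplex i).isClosed

theorem isCompact_support : IsCompact T.support := T.regular.1

theorem zero_mem_interior_support : (0 : E n) ∈ interior T.support := T.regular.2.2.1

/-- The finitely many simplexes that miss `x` are closed, so a small move from `x` cannot enter any
of them. -/
theorem eventually_mem_simplex (x : E n) :
    ∀ᶠ z in 𝓝 x, ∀ i, z ∈ T.simplex i → x ∈ T.simplex i := by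
  rw [eventually_all]
  intro i
  by_cases hx : x ∈ T.simplex i
  · exact .of_forall fun _ _ => hx
  · filter_upwards [(T.isClosed_simplex i).isOpen_compl.mem_nhds hx] with z hz hz'
    exact absurd hz' hz

theorem finite_vertices : T.vertices.Finite := by
  have : T.vertices = ⋃ i, range (T.vertex i) := by
    ext x
    simp [vertices]
  rw [this]
  exact finite_iUnion fun i => finite_range _

/-- A convex lower bound of the vertex values is a lower bound of the interpolation. -/
theorem le_cpa_of_convexOn {W : T.vertices → ℝ} {f : E n → ℝ} (hf : ConvexOn ℝ univ f)
    (h : ∀ v : T.vertices, f v ≤ W v) {x : E n} (hx : x ∈ T.support) : f x ≤ T.cpa W x := by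
  obtain ⟨i, hi⟩ := T.mem_support.1 hx
  rw [T.cpa_eq W hi]
  refine T.simplex_subset_of_convex (C := {z | f z ≤ T.affOn W i z}) ?_ (fun j => ?_) hi
  · intro y hy z hz a b ha hb hab
    simp only [mem_ofPred_eq] at hy hz ⊢
    rw [affOn_combo _ _ _ _ _ hab]
    refine (hf.2 (mem_univ y) (mem_univ z) ha hb hab).trans ?_
    simp only [smul_eq_mul]
    gcongr
  · rw [mem_ofPred_eq, affOn_vertex]
    exact h (T.vtx i j)

theorem cpaVec_mem_of_convex {m : ℕ} {U : T.vertices → E m} {C : Set (E m)} (hC : Convex ℝ C)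
    (h : ∀ v, U v ∈ C) {x : E n} (hx : x ∈ T.support) : T.cpaVec U x ∈ C := by
  obtain ⟨i, hi⟩ := T.mem_support.1 hx
  rw [T.cpaVec_eq U hi]
  refine T.simplex_subset_of_convex (C := {z | T.affVec U i z ∈ C}) ?_ (fun j => ?_) hi
  · intro y hy z hz a b ha hb hab
    simp only [mem_ofPred_eq] at hy hz ⊢
    rw [affVec_combo _ _ _ _ _ hab]
    exact hC hy hz ha hb hab
  · rw [mem_ofPred_eq, affVec_vertex]
    exact h _

theorem contDiff_affOn (W : T.vertices → ℝ) (i : Fin T.card) : ContDiff ℝ 1 (T.affOn W i) := by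
  exact contDiff_const.add (contDiff_const.inner ℝ (contDiff_id.sub contDiff_const))

theorem contDiff_affVec {m : ℕ} (U : T.vertices → E m) (i : Fin T.card) :
    ContDiff ℝ 1 (T.affVec U i) := by
  rw [contDiff_euclidean]
  exact fun k => T.contDiff_affOn (fun v => U v k) i

/-- Piecewise continuously differentiable functions are uniformly Lipschitz on the simplexes. -/
theorem exists_lipschitzOnWith_simplex {G : Type*} [NormedAddCommGroup G] [NormedSpace ℝ G]
    {f : E n → G} (h : Fin T.card → E n → G) (hh : ∀ i, ContDiff ℝ 1 (h i))
    (hf : ∀ i, EqOn f (h i) (T.simplex i)) :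
    ∃ K : ℝ≥0, ∀ i, LipschitzOnWith K f (T.simplex i) := by
  have : ∀ i, ∃ K : ℝ≥0, LipschitzOnWith K f (T.simplex i) := fun i => by
    obtain ⟨K, hK⟩ := LocallyLipschitzOn.exists_lipschitzOnWith_of_compact
      (T.isCompact_simplex i) (hh i).locallyLipschitz.locallyLipschitzOn
    refine ⟨K, fun x hx y hy => ?_⟩
    rw [hf i hx, hf i hy]
    exact hK hx hy
  choose K hK using this
  exact ⟨Finset.univ.sup K, fun i => (hK i).weaken (Finset.le_sup (Finset.mem_univ i))⟩

theorem continuousOn_support {G : Type*} [PseudoMetricSpace G] {f : E n → G} {K : ℝ≥0}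
    (hf : ∀ i, LipschitzOnWith K f (T.simplex i)) : ContinuousOn f T.support :=
  (locallyFinite_of_finite _).continuousOn_iUnion T.isClosed_simplex fun i => (hf i).continuousOn

theorem exists_lipschitzOnWith_cpa (W : T.vertices → ℝ) :
    ∃ K : ℝ≥0, ∀ i, LipschitzOnWith K (T.cpa W) (T.simplex i) :=
  T.exists_lipschitzOnWith_simplex (T.affOn W) (T.contDiff_affOn W) fun _ _ hx => T.cpa_eq W hx

theorem continuousOn_cpa (W : T.vertices → ℝ) : ContinuousOn (T.cpa W) T.support :=
  T.continuousOn_support (T.exists_lipschitzOnWith_cpa W).choose_spec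

theorem cpa_vertex (W : T.vertices → ℝ) (v : T.vertices) : T.cpa W v = W v := by
  obtain ⟨_, i, j, rfl⟩ := v
  have hi : T.vertex i j ∈ T.simplex i := subset_convexHull ℝ _ (mem_range_self j)
  exact (T.cpa_eq W hi).trans (T.affOn_vertex W i j)

theorem cpaVec_vertex {m : ℕ} (U : T.vertices → E m) (v : T.vertices) : T.cpaVec U v = U v := by
  ext k
  exact T.cpa_vertex (fun v => U v k) v

/-- There are finitely many vertices, so a small slope `c` works at all of them, and convexity of
the norm does the rest. A linear bound, unlike the power `a`, matches the linear upper bound near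
`0`. -/
theorem exists_norm_le (W : T.vertices → ℝ) (h : ∀ v, v ≠ T.origin → 0 < W v)
    (h0 : W T.origin = 0) : ∃ c : ℝ, 0 < c ∧ ∀ x ∈ T.support, c * ‖x‖ ≤ T.cpa W x := by
  have := T.finite_vertices.to_subtype
  have : ∃ c : ℝ, 0 < c ∧ ∀ v : T.vertices, c * ‖(v : E n)‖ ≤ W v := by
    have h1 : ∀ v : T.vertices, ∀ᶠ c in 𝓝[>] (0 : ℝ), c * ‖(v : E n)‖ ≤ W v := by
      intro v
      by_cases hv : v = T.origin
      · subst hv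
        rw [h0]
        simp [origin]
      · have : Tendsto (fun c : ℝ => c * ‖(v : E n)‖) (𝓝[>] 0) (𝓝 0) := by
          have h2 : Continuous (fun c : ℝ => c * ‖(v : E n)‖) := by fun_prop
          have h3 := h2.tendsto 0
          rw [zero_mul] at h3
          exact h3.mono_left nhdsWithin_le_nhds
        exact (this.eventually (gt_mem_nhds (h v hv))).mono fun _ h => le_of_lt h
    obtain ⟨c, hc, hc'⟩ := ((eventually_all.2 h1).and self_mem_nhdsWithin).exists
    exact ⟨c, hc', hc⟩
  obtain ⟨c, hc, hv⟩ := this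
  refine ⟨c, hc, fun x hx => T.le_cpa_of_convexOn (f := fun x => c * ‖x‖) ?_ hv hx⟩
  exact convexOn_univ_norm.smul hc.le

/-- Near `0` every simplex containing `x` also contains `0`, so the Lipschitz bound on that simplex
compares `x` with `0`. -/
theorem exists_le_norm (W : T.vertices → ℝ) (h0 : W T.origin = 0) :
    ∃ δ L : ℝ, 0 < δ ∧ 0 < L ∧ Metric.ball 0 δ ⊆ T.support ∧
      ∀ x : E n, ‖x‖ < δ → T.cpa W x ≤ L * ‖x‖ := by
  have h1 : ∀ᶠ x in 𝓝 (0 : E n), x ∈ T.support :=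
    mem_interior_iff_mem_nhds.1 T.zero_mem_interior_support
  obtain ⟨δ, hδ, h⟩ := Metric.eventually_nhds_iff_ball.1 (h1.and (T.eventually_mem_simplex 0))
  obtain ⟨K, hK⟩ := T.exists_lipschitzOnWith_cpa W
  refine ⟨δ, K + 1, hδ, by positivity, fun x hx => (h x hx).1, fun x hx => ?_⟩
  obtain ⟨hx1, hx2⟩ := h x (by simpa using hx)
  obtain ⟨i, hi⟩ := T.mem_support.1 hx1
  have h2 := (hK i).dist_le_mul x hi 0 (hx2 i hi)
  have h3 : T.cpa W 0 = 0 := (T.cpa_vertex W T.origin).trans h0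
  rw [h3, dist_zero_right, dist_zero_right] at h2
  have := le_abs_self (T.cpa W x)
  rw [Real.norm_eq_abs] at h2
  nlinarith [norm_nonneg x]

end Triangulation

/-! ### Lipschitz curves, Dini derivatives and Gronwall -/

/-- A function that is Lipschitz on each member of a finite closed cover of an interval satisfies
the same Lipschitz bound between the end points. -/
theorem dist_le_of_closed_cover {ι G : Type*} [PseudoMetricSpace G] [DecidableEq ι] {f : ℝ → G}
    {K : ℝ} (C : ι → Set ℝ) (hC : ∀ i, IsClosed (C i)) (hf : ∀ i, ∀ s ∈ C i, ∀ t ∈ C i, s ≤ t →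
      dist (f s) (f t) ≤ K * (t - s)) (S : Finset ι) (a b : ℝ) (hab : a ≤ b)
    (hS : Icc a b ⊆ ⋃ i ∈ S, C i) : dist (f a) (f b) ≤ K * (b - a) := by
  induction hn : S.card generalizing S a with
  | zero =>
    rw [Finset.card_eq_zero] at hn
    subst hn
    simpa using hS (left_mem_Icc.2 hab)
  | succ k ih =>
    obtain ⟨i, hi, hai⟩ := mem_iUnion₂.1 (hS (left_mem_Icc.2 hab))
    have hcl : IsCompact (C i ∩ Icc a b) := isCompact_Icc.inter_left (hC i)
    -- `q` is the last time in `C i`. After it the set `C i` is no longer needed, so the induction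
    -- continues on `[q, b]` with one set fewer.
    obtain ⟨q, ⟨hqC, hqa, hqb⟩, hq⟩ :=
      hcl.exists_isGreatest ⟨a, hai, left_mem_Icc.2 hab⟩
    have h1 := hf i a hai q hqC hqa
    rcases hqb.eq_or_lt with rfl | hqb
    · exact h1
    have h2 : Ioo q b ⊆ ⋃ j ∈ S.erase i, C j := by
      intro t ht
      obtain ⟨j, hj, htj⟩ := mem_iUnion₂.1 (hS ⟨hqa.trans ht.1.le, ht.2.le⟩)
      refine mem_iUnion₂.2 ⟨j, Finset.mem_erase.2 ⟨?_, hj⟩, htj⟩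
      rintro rfl
      exact (hq ⟨htj, hqa.trans ht.1.le, ht.2.le⟩).not_gt ht.1
    have h3 : Icc q b ⊆ ⋃ j ∈ S.erase i, C j := by
      rw [← closure_Ioo hqb.ne]
      exact closure_minimal h2 (isClosed_biUnion_finset fun j _ => hC j)
    have h4 := ih (S.erase i) q hqb.le h3 (by rw [Finset.card_erase_of_mem hi, hn]; rfl)
    calc dist (f a) (f b) ≤ dist (f a) (f q) + dist (f q) (f b) := dist_triangle _ _ _
      _ ≤ K * (q - a) + K * (b - q) := add_le_add h1 h4
      _ = K * (b - a) := by ring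

theorem lipschitzOnWith_Icc_of_dist_le {G : Type*} [PseudoMetricSpace G] {f : ℝ → G} {K : ℝ≥0}
    {a b : ℝ} (h : ∀ s t, a ≤ s → s ≤ t → t ≤ b → dist (f s) (f t) ≤ K * (t - s)) :
    LipschitzOnWith K f (Icc a b) := by
  refine LipschitzOnWith.of_dist_le_mul fun s hs t ht => ?_
  rcases le_total s t with hst | hst
  · rw [dist_comm s t, Real.dist_eq, abs_of_nonneg (sub_nonneg.2 hst)]
    exact h s t hs.1 hst ht.2
  · rw [dist_comm, Real.dist_eq, abs_of_nonneg (sub_nonneg.2 hst)]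
    exact h t s ht.1 hst hs.2

/-- Composition of a Lipschitz curve in a finite union of closed sets with a function that is
Lipschitz on each of them. -/
theorem lipschitzOnWith_comp_of_closed_cover {ι X G : Type*} [Finite ι] [PseudoMetricSpace X]
    [PseudoMetricSpace G] {D : ι → Set X} (hD : ∀ i, IsClosed (D i)) {f : X → G} {L K : ℝ≥0}
    (hf : ∀ i, LipschitzOnWith L f (D i)) {φ : ℝ → X} {a b : ℝ}
    (hφ : LipschitzOnWith K φ (Icc a b)) (hmem : ∀ t ∈ Icc a b, φ t ∈ ⋃ i, D i) :
    LipschitzOnWith (L * K) (f ∘ φ) (Icc a b) := by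
  classical
  have := Fintype.ofFinite ι
  refine lipschitzOnWith_Icc_of_dist_le fun s t has hst htb => ?_
  have hsub : Icc s t ⊆ Icc a b := Icc_subset_Icc has htb
  refine dist_le_of_closed_cover (fun i => Icc s t ∩ φ ⁻¹' D i)
    (fun i => (hφ.continuousOn.mono hsub).preimage_isClosed_of_isClosed isClosed_Icc (hD i))
    (fun i p hp q hq hpq => ?_) Finset.univ s t hst fun p hp => ?_
  · have h1 := (hf i).dist_le_mul _ hp.2 _ hq.2
    have h2 := hφ.dist_le_mul _ (hsub hp.1) _ (hsub hq.1)
    rw [dist_comm p q, Real.dist_eq, abs_of_nonneg (sub_nonneg.2 hpq)] at h2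
    calc dist (f (φ p)) (f (φ q)) ≤ L * dist (φ p) (φ q) := h1
      _ ≤ L * (K * (q - p)) := by gcongr
      _ = _ := by push_cast; ring
  · obtain ⟨i, hi⟩ := mem_iUnion.1 (hmem p (hsub hp))
    exact mem_iUnion₂.2 ⟨i, Finset.mem_univ i, hp, hi⟩

theorem absolutelyContinuousOnInterval_inner {n : ℕ} {φ : ℝ → E n} {a b : ℝ}
    (h : AbsolutelyContinuousOnInterval φ a b) (d : E n) :
    AbsolutelyContinuousOnInterval (fun t => ⟪d, φ t⟫) a b := by
  rw [absolutelyContinuousOnInterval_iff] at h ⊢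
  intro ε hε
  obtain ⟨δ, hδ, H⟩ := h (ε / (‖d‖ + 1)) (by positivity)
  refine ⟨δ, hδ, fun I hI hI' => ?_⟩
  have h1 := H I hI hI'
  rw [lt_div_iff₀ (by positivity), Finset.sum_mul] at h1
  refine (Finset.sum_le_sum fun i _ => ?_).trans_lt h1
  rw [Real.dist_eq, ← inner_sub_right, dist_eq_norm]
  have := abs_real_inner_le_norm d (φ (I.2 i).1 - φ (I.2 i).2)
  nlinarith [norm_nonneg (φ (I.2 i).1 - φ (I.2 i).2)]

/-- Pairing `φ` with the fixed increment `d` reduces the claim to the scalar fundamental theorem of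
calculus, which gives `‖d‖ ^ 2 ≤ ‖d‖ * M * (t - s)`. -/
theorem IsSolutionOn.lipschitzOnWith {n : ℕ} {F : E n → Set (E n)} {D : Set (E n)} {M : ℝ≥0}
    (hM : ∀ x ∈ D, ∀ v ∈ F x, ‖v‖ ≤ M) {φ : ℝ → E n} {t₀ t₁ : ℝ}
    (h : IsSolutionOn F D φ t₀ t₁) : LipschitzOnWith M φ (Icc t₀ t₁) := by
  refine lipschitzOnWith_Icc_of_dist_le fun s t hs hst ht => ?_
  set d := φ t - φ s with hd
  have hac : AbsolutelyContinuousOnInterval (fun t => ⟪d, φ t⟫) s t :=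
    absolutelyContinuousOnInterval_inner (h.absCont.mono (by
      rw [uIcc_of_le hst, uIcc_of_le (hs.trans (hst.trans ht))]
      exact Icc_subset_Icc hs ht)) d
  have h1 := hac.integral_deriv_eq_sub
  have h2 : ‖∫ x in s..t, _root_.deriv (fun t => ⟪d, φ t⟫) x‖ ≤ (‖d‖ * M) * |t - s| := by
    refine intervalIntegral.norm_integral_le_of_norm_le_const_ae ?_
    filter_upwards [h.deriv, Measure.ae_ne volume t] with x hx hxt hmem
    rw [uIoc_of_le hst] at hmem
    have hlt : x < t := lt_of_le_of_ne hmem.2 hxt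
    have hx' : x ∈ Ioo t₀ t₁ := ⟨hs.trans_lt hmem.1, hlt.trans_le ht⟩
    obtain ⟨v, hv, hder⟩ := hx hx'
    have h3 : HasDerivAt (fun t => ⟪d, φ t⟫) ⟪d, v⟫ x := by
      simpa using (hasDerivAt_const x d).inner ℝ hder
    rw [h3.deriv]
    exact (norm_inner_le_norm d v).trans
      (by gcongr; exact hM _ (h.mem x (Ioo_subset_Icc_self hx')) v hv)
  rw [h1, ← inner_sub_right, ← hd, real_inner_self_eq_norm_sq, abs_of_nonneg (sub_nonneg.2 hst),
    Real.norm_of_nonneg (sq_nonneg _)] at h2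
  rw [dist_comm, dist_eq_norm, ← hd]
  rcases (norm_nonneg d).eq_or_lt with h0 | h0
  · rw [← h0]
    exact mul_nonneg M.2 (sub_nonneg.2 hst)
  · refine le_of_mul_le_mul_left ?_ h0
    linarith

/-- For almost every `t`, every member of a finite family of sets that contains `t` accumulates
at `t` from the right. -/
theorem ae_neBot_nhdsWithin_inter_Ioi {ι : Type*} [Finite ι] (C : ι → Set ℝ) :
    ∀ᵐ t, ∀ i, t ∈ C i → (𝓝[C i ∩ Ioi t] t).NeBot := by
  rw [ae_all_iff]
  intro i
  filter_upwards [(countable_setOfPred_isolated_right_within (s := C i)).ae_notMem volume] with t ht hti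
  exact ⟨fun h => ht ⟨hti, h⟩⟩

/-- A difference quotient is the mean of the derivative over `[t, t + h]`, and by continuity `c`
stays below `r` there for small `h`. -/
theorem eventually_slope_le_of_ae_deriv_le {w c : ℝ → ℝ} {a b : ℝ}
    (hw : AbsolutelyContinuousOnInterval w a b) (hc : ContinuousOn c (Icc a b))
    (hd : ∀ᵐ t, t ∈ Ioo a b → deriv w t ≤ c t) {t : ℝ} (ht : t ∈ Ico a b) {r : ℝ} (hr : c t < r) :
    ∀ᶠ h in 𝓝[>] (0 : ℝ), (w (t + h) - w t) / h ≤ r := by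
  have hab : a ≤ b := ht.1.trans ht.2.le
  have h1 : ∀ᶠ s in 𝓝[Icc a b] t, c s < r :=
    (hc t ⟨ht.1, ht.2.le⟩).eventually (gt_mem_nhds hr)
  rw [eventually_nhdsWithin_iff] at h1
  obtain ⟨ε, hε, h2⟩ := Metric.eventually_nhds_iff_ball.1 h1
  have h3 : ∀ᶠ h in 𝓝[>] (0 : ℝ), h < min ε (b - t) :=
    nhdsWithin_le_nhds (gt_mem_nhds (lt_min hε (sub_pos.2 ht.2)))
  filter_upwards [h3, self_mem_nhdsWithin] with h hh (h0 : 0 < h)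
  obtain ⟨hhε, hhb⟩ := lt_min_iff.1 hh
  have hac : AbsolutelyContinuousOnInterval w t (t + h) := hw.mono (by
    rw [uIcc_of_le hab, uIcc_of_le (by linarith)]
    exact Icc_subset_Icc ht.1 (by linarith))
  rw [div_le_iff₀ h0, ← hac.integral_deriv_eq_sub]
  have h4 : ∫ x in t..(t + h), deriv w x ≤ ∫ _ in t..(t + h), r := by
    refine intervalIntegral.integral_mono_ae_restrict (by linarith) hac.intervalIntegrable_deriv
      intervalIntegrable_const ?_
    rw [EventuallyLE, ae_restrict_iff' measurableSet_Icc]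
    filter_upwards [hd, Measure.ae_ne volume t] with x hx hxt hmem
    have hlt : t < x := lt_of_le_of_ne hmem.1 (Ne.symm hxt)
    refine (hx ⟨ht.1.trans_lt hlt, by linarith [hmem.2]⟩).trans (h2 x ?_ ?_).le
    · rw [Metric.mem_ball, Real.dist_eq, abs_of_pos (by linarith)]
      linarith [hmem.2]
    · exact ⟨ht.1.trans hlt.le, by linarith [hmem.2]⟩
  rw [intervalIntegral.integral_const, add_sub_cancel_left, smul_eq_mul] at h4
  linarith

theorem upperDini_le {g : ℝ → ℝ} {c : ℝ}
    (h : ∀ r, c < r → ∀ᶠ h in 𝓝[>] (0 : ℝ), (g h - g 0) / h ≤ r) : upperDini g ≤ (c : EReal) := by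
  refine EReal.le_of_forall_lt_iff_le.1 fun r hr => ?_
  refine limsup_le_of_le (by isBoundedDefault) ?_
  filter_upwards [h r (by exact_mod_cast hr)] with x hx
  exact_mod_cast hx

theorem le_mul_exp_of_eventually_slope_le {w : ℝ → ℝ} {a b K : ℝ} (hw : ContinuousOn w (Icc a b))
    (h : ∀ t ∈ Ico a b, ∀ r, -(K * w t) < r →
      ∀ᶠ h in 𝓝[>] (0 : ℝ), (w (t + h) - w t) / h ≤ r) {t : ℝ} (ht : t ∈ Icc a b) :
    w t ≤ w a * Real.exp (-(K * (t - a))) := by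
  have := le_gronwallBound_of_liminf_deriv_right_le (f' := fun t => -(K * w t)) (δ := w a)
    (K := -K) (ε := 0) hw (fun x hx r hr => ?_) le_rfl (fun x _ => by simp) t ht
  · rwa [gronwallBound_ε0, neg_mul] at this
  -- Gronwall asks for a strict inequality; the intermediate `r'` provides it.
  · obtain ⟨r', hr1, hr2⟩ := exists_between hr
    have h1 := h x hx r' hr1
    have h2 : Tendsto (fun z => z - x) (𝓝[>] x) (𝓝[>] 0) := by
      refine tendsto_nhdsWithin_iff.2 ⟨?_, ?_⟩
      · have : Continuous fun z => z - x := by fun_prop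
        simpa using (this.tendsto x).mono_left nhdsWithin_le_nhds
      · filter_upwards [self_mem_nhdsWithin] with z hz
        exact sub_pos.2 (mem_Ioi.1 hz)
    refine (Eventually.frequently ?_)
    filter_upwards [h2.eventually h1] with z hz
    rw [add_sub_cancel, div_eq_inv_mul] at hz
    exact hz.trans_lt hr2

/-! ### Decay of the interpolation along solutions -/

namespace Triangulation

variable {n : ℕ} (T : Triangulation n)

/-- The differential inclusion whose velocities at `x` are the values at `x` of the vector fields
of the simplexes that contain `x`. -/
def inclusion (X : Fin T.card → E n → E n) (x : E n) : Set (E n) :=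
  {v | ∃ i, x ∈ T.simplex i ∧ v = X i x}

theorem exists_norm_inclusion_le {X : Fin T.card → E n → E n} (hX : ∀ i, Continuous (X i)) :
    ∃ M : ℝ≥0, ∀ x ∈ T.support, ∀ v ∈ T.inclusion X x, ‖v‖ ≤ M := by
  have : ∀ i, ∃ M : ℝ≥0, ∀ x ∈ T.simplex i, ‖X i x‖ ≤ M := fun i => by
    obtain ⟨C, hC⟩ := (T.isCompact_simplex i).exists_bound_of_continuousOn (hX i).continuousOn
    exact ⟨C.toNNReal, fun x hx => (hC x hx).trans (Real.le_coe_toNNReal C)⟩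
  choose M hM using this
  refine ⟨Finset.univ.sup M, ?_⟩
  rintro x - v ⟨i, hi, rfl⟩
  exact (hM i x hi).trans (NNReal.coe_le_coe.2 (Finset.le_sup (Finset.mem_univ i)))

variable {T} {X : Fin T.card → E n → E n} {W : T.vertices → ℝ} {φ : ℝ → E n} {t₀ t₁ b : ℝ}

theorem exists_lipschitzOnWith_cpa_comp (hX : ∀ i, Continuous (X i))
    (h : IsSolutionOn (T.inclusion X) T.support φ t₀ t₁) :
    ∃ K : ℝ≥0, LipschitzOnWith K (T.cpa W ∘ φ) (Icc t₀ t₁) := by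
  obtain ⟨M, hM⟩ := T.exists_norm_inclusion_le hX
  obtain ⟨L, hL⟩ := T.exists_lipschitzOnWith_cpa W
  exact ⟨L * M, lipschitzOnWith_comp_of_closed_cover T.isClosed_simplex hL
    (h.lipschitzOnWith hM) h.mem⟩

/-- The chain rule fails on faces, so the derivative, known to exist for almost every `t`, is
computed only along later times at which `φ` lies in the simplex supplying the velocity. There `V ∘
φ` coincides with a differentiable function. -/
theorem ae_deriv_cpa_comp_le (hX : ∀ i, Continuous (X i))
    (hdec : ∀ i, ∀ x ∈ T.simplex i, ⟪T.grad W i, X i x⟫ ≤ -(b * T.cpa W x))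
    (h : IsSolutionOn (T.inclusion X) T.support φ t₀ t₁) :
    ∀ᵐ t, t ∈ Ioo t₀ t₁ → deriv (T.cpa W ∘ φ) t ≤ -(b * T.cpa W (φ t)) := by
  obtain ⟨K, hK⟩ := exists_lipschitzOnWith_cpa_comp (W := W) hX h
  rw [← uIcc_of_le h.le] at hK
  filter_upwards [h.deriv, hK.absolutelyContinuousOnInterval.ae_differentiableAt,
    ae_neBot_nhdsWithin_inter_Ioi fun i => φ ⁻¹' T.simplex i] with t h1 h2 h3 ht
  obtain ⟨v, ⟨i, hi, rfl⟩, hv⟩ := h1 ht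
  have hw := (h2 (uIcc_of_le h.le ▸ Ioo_subset_Icc_self ht)).hasDerivAt
  have hne : (𝓝[φ ⁻¹' T.simplex i ∩ Ioi t] t).NeBot := h3 i hi
  have ha : HasDerivAt (fun s => T.affOn W i (φ s)) ⟪T.grad W i, X i (φ t)⟫ t := by
    have := (hasDerivAt_const t (T.grad W i)).inner ℝ (hv.sub_const (T.vertex i 0))
    simpa [affOn] using this.const_add (W (T.vtx i 0))
  have e1 := hasDerivWithinAt_iff_tendsto_slope.1
    (hw.hasDerivWithinAt (s := φ ⁻¹' T.simplex i ∩ Ioi t))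
  have e2 := hasDerivWithinAt_iff_tendsto_slope.1
    (ha.hasDerivWithinAt (s := φ ⁻¹' T.simplex i ∩ Ioi t))
  have hs : (φ ⁻¹' T.simplex i ∩ Ioi t) \ {t} = φ ⁻¹' T.simplex i ∩ Ioi t :=
    sdiff_singleton_eq_self fun h => lt_irrefl t h.2
  rw [hs] at e1 e2
  have e3 : deriv (T.cpa W ∘ φ) t = ⟪T.grad W i, X i (φ t)⟫ := by
    refine tendsto_nhds_unique (e1.congr' ?_) e2
    filter_upwards [self_mem_nhdsWithin] with s hs
    simp only [slope_def_field, Function.comp]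
    rw [T.cpa_eq W hs.1, T.cpa_eq W hi]
  rw [e3]
  exact hdec i _ hi

theorem eventually_slope_cpa_comp_le (hX : ∀ i, Continuous (X i))
    (hdec : ∀ i, ∀ x ∈ T.simplex i, ⟪T.grad W i, X i x⟫ ≤ -(b * T.cpa W x))
    (h : IsSolutionOn (T.inclusion X) T.support φ t₀ t₁) {t : ℝ} (ht : t ∈ Ico t₀ t₁) {r : ℝ}
    (hr : -(b * T.cpa W (φ t)) < r) :
    ∀ᶠ h in 𝓝[>] (0 : ℝ), (T.cpa W (φ (t + h)) - T.cpa W (φ t)) / h ≤ r := by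
  obtain ⟨K, hK⟩ := exists_lipschitzOnWith_cpa_comp (W := W) hX h
  have hc : ContinuousOn (fun t => -(b * T.cpa W (φ t))) (Icc t₀ t₁) :=
    (continuousOn_const.mul hK.continuousOn).neg
  rw [← uIcc_of_le h.le] at hK
  exact eventually_slope_le_of_ae_deriv_le hK.absolutelyContinuousOnInterval hc
    (ae_deriv_cpa_comp_le hX hdec h) ht hr

theorem upperDini_cpa_comp_le (hX : ∀ i, Continuous (X i))
    (hdec : ∀ i, ∀ x ∈ T.simplex i, ⟪T.grad W i, X i x⟫ ≤ -(b * T.cpa W x))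
    (h : IsSolutionOn (T.inclusion X) T.support φ t₀ t₁) {t : ℝ} (ht : t ∈ Ico t₀ t₁) :
    upperDini (fun h => T.cpa W (φ (t + h))) ≤ ((-(b * T.cpa W (φ t)) : ℝ) : EReal) := by
  refine upperDini_le fun r hr => ?_
  simpa using eventually_slope_cpa_comp_le hX hdec h ht hr

theorem cpa_comp_le_mul_exp (hX : ∀ i, Continuous (X i))
    (hdec : ∀ i, ∀ x ∈ T.simplex i, ⟪T.grad W i, X i x⟫ ≤ -(b * T.cpa W x))
    (h : IsSolutionOn (T.inclusion X) T.support φ t₀ t₁) {t : ℝ} (ht : t ∈ Icc t₀ t₁) :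
    T.cpa W (φ t) ≤ T.cpa W (φ t₀) * Real.exp (-(b * (t - t₀))) := by
  obtain ⟨K, hK⟩ := exists_lipschitzOnWith_cpa_comp (W := W) hX h
  exact le_mul_exp_of_eventually_slope_le hK.continuousOn
    (fun t ht r hr => eventually_slope_cpa_comp_le hX hdec h ht hr) ht

end Triangulation

/-! ### Existence and continuation of solutions -/

/-- A function that is Lipschitz on each of finitely many closed sets is Lipschitz on every convex
set that they cover. -/
theorem lipschitzOnWith_of_convex_of_closed_cover {ι X G : Type*} [Finite ι]
    [NormedAddCommGroup X] [NormedSpace ℝ X] [PseudoMetricSpace G] {D : ι → Set X}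
    (hD : ∀ i, IsClosed (D i)) {f : X → G} {L : ℝ≥0} (hf : ∀ i, LipschitzOnWith L f (D i))
    {B : Set X} (hB : Convex ℝ B) (hsub : B ⊆ ⋃ i, D i) : LipschitzOnWith L f B := by
  refine LipschitzOnWith.of_dist_le_mul fun x hx y hy => ?_
  have h := lipschitzOnWith_comp_of_closed_cover hD hf
    ((lipschitzWith_lineMap (𝕜 := ℝ) x y).lipschitzOnWith (s := Icc 0 1))
    fun t ht => hsub (hB.lineMap_mem hx hy ht)
  simpa using h.dist_le_mul 0 (by simp) 1 (by simp)

/-- The Picard-Lindelöf theorem for an autonomous equation, with a solution in the ball. -/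
theorem exists_hasDerivWithinAt_mem_closedBall {G : Type*} [NormedAddCommGroup G]
    [NormedSpace ℝ G] [CompleteSpace G] {f : G → G} {x : G} {a M K : ℝ≥0} {η : ℝ} (hη : 0 ≤ η)
    (hf : LipschitzOnWith K f (Metric.closedBall x a))
    (hM : ∀ z ∈ Metric.closedBall x a, ‖f z‖ ≤ M) (h : M * η ≤ a) :
    ∃ α : ℝ → G, α 0 = x ∧ ∀ t ∈ Icc 0 η, α t ∈ Metric.closedBall x a ∧
      HasDerivWithinAt α (f (α t)) (Icc 0 η) t := by
  have hp : IsPicardLindelof (fun _ => f) (⟨0, left_mem_Icc.2 hη⟩ : Icc 0 η) x a 0 M K :=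
    .of_time_independent hM hf (by simpa [hη] using h)
  obtain ⟨α, hα⟩ := ODE.FunSpace.exists_isFixedPt_next hp (Metric.mem_closedBall_self le_rfl)
  refine ⟨α.compProj, ?_, fun t ht => ⟨α.compProj_mem_closedBall hp.mul_max_le, ?_⟩⟩
  · have := ODE.FunSpace.compProj_val (α := α) (t := ⟨0, left_mem_Icc.2 hη⟩)
    rw [this, ← hα, ODE.FunSpace.next_apply₀]
  · refine (ODE.hasDerivWithinAt_picard_Icc (left_mem_Icc.2 hη) hp.continuousOn_uncurry
      α.continuous_compProj.continuousOn (fun _ _ => α.compProj_mem_closedBall hp.mul_max_le)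
      x ht).congr_of_mem ?_ ht
    intro s hs
    nth_rw 1 [← hα]
    rw [ODE.FunSpace.compProj_of_mem hs, ODE.FunSpace.next_apply]

/-- Solutions of a uniform duration from all points of a set, within the set, can be continued for
all times. -/
theorem hasGlobalSolution_of_uniform_step {n : ℕ} {F : E n → Set (E n)} {D : Set (E n)} {η : ℝ}
    {M : ℝ≥0} (hη : 0 < η)
    (h : ∀ x ∈ D, ∃ α : ℝ → E n, α 0 = x ∧ (∀ t ∈ Icc 0 η, α t ∈ D) ∧
      LipschitzOnWith M α (Icc 0 η) ∧ ∀ t ∈ Ioo 0 η, ∃ v ∈ F (α t), HasDerivAt α v t)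
    (t₀ : ℝ) {x₀ : E n} (hx₀ : x₀ ∈ D) : HasGlobalSolution F D t₀ x₀ := by
  choose! α hα0 hαD hαL hα using h
  let X : ℕ → E n := fun k => (fun x => α x η)^[k] x₀
  have hX : ∀ k, X k ∈ D := by
    intro k
    induction k with
    | zero => exact hx₀
    | succ k ih =>
      simp only [X, Function.iterate_succ_apply']
      exact hαD _ ih η (right_mem_Icc.2 hη.le)
  have hXs : ∀ k, α (X k) η = X (k + 1) := fun k => by
    simp only [X, Function.iterate_succ_apply']
  let φ : ℝ → E n := fun t => α (X ⌊(t - t₀) / η⌋₊) (t - t₀ - ⌊(t - t₀) / η⌋₊ * η)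
  have hφ : ∀ (k : ℕ) (t : ℝ), t - t₀ - k * η ∈ Icc 0 η → φ t = α (X k) (t - t₀ - k * η) := by
    intro k t ht
    -- At the right end of step `k` the floor is already `k + 1`; the two formulas agree because
    -- each piece starts where the previous one ends.
    rcases ht.2.eq_or_lt with he | hlt
    · have hk : (t - t₀) / η = (k + 1 : ℕ) := by
        rw [div_eq_iff hη.ne']
        push_cast
        linarith
      have hk' : t - t₀ - ((k + 1 : ℕ) : ℝ) * η = 0 := by
        push_cast
        linarith
      simp only [φ]
      rw [hk, Nat.floor_natCast, hk', he, hα0 _ (hX _), hXs]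
    · have hk : ⌊(t - t₀) / η⌋₊ = k := by
        have h0 : (0 : ℝ) ≤ k * η := by positivity
        rw [Nat.floor_eq_iff (div_nonneg (by linarith [ht.1]) hη.le), le_div_iff₀ hη,
          div_lt_iff₀ hη]
        exact ⟨by linarith [ht.1], by linarith⟩
      simp only [φ, hk]
  have hex : ∀ t, t₀ ≤ t → t - t₀ - ⌊(t - t₀) / η⌋₊ * η ∈ Ico 0 η := by
    intro t ht
    have h1 := Nat.floor_le (div_nonneg (sub_nonneg.2 ht) hη.le)
    have h2 := Nat.lt_floor_add_one ((t - t₀) / η)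
    rw [le_div_iff₀ hη] at h1
    rw [div_lt_iff₀ hη] at h2
    exact ⟨by linarith, by linarith⟩
  refine ⟨φ, ?_, fun t₁ h₁ => ⟨h₁, fun t ht => ?_, ?_, ?_⟩⟩
  · rw [hφ 0 t₀ (by simp [hη.le])]
    simpa [X] using hα0 _ hx₀
  · rw [hφ _ t (Ico_subset_Icc_self (hex t ht.1))]
    exact hαD _ (hX _) _ (Ico_subset_Icc_self (hex t ht.1))
  · refine LipschitzOnWith.absolutelyContinuousOnInterval (K := M) ?_
    rw [uIcc_of_le h₁]
    refine lipschitzOnWith_Icc_of_dist_le fun s t hs hst ht => ?_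
    refine dist_le_of_closed_cover (fun k : ℕ => (fun t => t - t₀ - k * η) ⁻¹' Icc 0 η)
      (fun k => isClosed_Icc.preimage (by fun_prop)) (fun k p hp q hq hpq => ?_)
      (Finset.range (⌊(t - t₀) / η⌋₊ + 1)) s t hst fun p hp => ?_
    · rw [hφ k p hp, hφ k q hq]
      refine ((hαL _ (hX k)).dist_le_mul _ hp _ hq).trans_eq ?_
      rw [dist_comm, Real.dist_eq, abs_of_nonneg (by linarith)]
      ring
    · refine mem_iUnion₂.2 ⟨⌊(p - t₀) / η⌋₊, ?_,
        Ico_subset_Icc_self (hex p (hs.trans hp.1))⟩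
      rw [Finset.mem_range, Nat.lt_succ_iff]
      exact Nat.floor_mono (by gcongr; exact hp.2)
  -- Differentiability may fail at the junction times, a null set.
  · have hc : (range fun k : ℕ => t₀ + k * η).Countable := countable_range _
    filter_upwards [hc.ae_notMem volume] with t htc ht
    set k := ⌊(t - t₀) / η⌋₊ with hk
    have h1 : t - t₀ - k * η ∈ Ico 0 η := hex t ht.1.le
    have h2 : t - t₀ - k * η ∈ Ioo 0 η :=
      ⟨lt_of_le_of_ne h1.1 fun h0 => htc ⟨k, by linarith⟩, h1.2⟩
    obtain ⟨v, hv, hd⟩ := hα _ (hX k) _ h2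
    rw [hφ k t (Ioo_subset_Icc_self h2)]
    refine ⟨v, hv, ?_⟩
    have hd' : HasDerivAt (α (X k) ∘ fun s => s - t₀ - k * η) v t := by
      have := hd.scomp t (((hasDerivAt_id t).sub_const t₀).sub_const (k * η))
      simpa using this
    refine hd'.congr_of_eventuallyEq ?_
    have hcont : Continuous fun s => s - t₀ - k * η := by fun_prop
    filter_upwards [hcont.tendsto t |>.eventually (Ioo_mem_nhds h2.1 h2.2)] with s hs
    exact hφ k s (Ioo_subset_Icc_self hs)

namespace Triangulation

variable {n : ℕ} {T : Triangulation n} {X : Fin T.card → E n → E n} {W : T.vertices → ℝ} {b : ℝ}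

/-- The nearby point `x + h • v` shares a simplex with `x`, and single-valuedness makes `v` the
velocity of that simplex too. Negative `h` is allowed, as `cpa_lt_of_mem_interior` needs. -/
theorem eventually_cpa_add_smul (hs : ∀ x ∈ T.support, (T.inclusion X x).Subsingleton) {x v : E n}
    (hx : x ∈ interior T.support) (hv : v ∈ T.inclusion X x) :
    ∀ᶠ h in 𝓝 (0 : ℝ), x + h • v ∈ T.support ∧ ∃ i, x ∈ T.simplex i ∧
      T.cpa W (x + h • v) = T.cpa W x + h * ⟪T.grad W i, X i x⟫ := by
  have hc : Continuous fun h : ℝ => x + h • v := by fun_prop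
  have h0 : Tendsto (fun h : ℝ => x + h • v) (𝓝 0) (𝓝 x) := by simpa using hc.tendsto 0
  have h1 : ∀ᶠ z in 𝓝 x, z ∈ T.support := mem_interior_iff_mem_nhds.1 hx
  filter_upwards [h0.eventually (h1.and (T.eventually_mem_simplex x))] with h hh
  obtain ⟨i, hi⟩ := T.mem_support.1 hh.1
  have hxi := hh.2 i hi
  refine ⟨hh.1, i, hxi, ?_⟩
  have hvi : X i x = v := hs x (interior_subset hx) ⟨i, hxi, rfl⟩ hv
  rw [T.cpa_eq W hi, T.cpa_eq W hxi, hvi]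
  have := T.affOn_sub W i (x + h • v) x
  rw [add_sub_cancel_left, inner_smul_right] at this
  linarith

theorem upperDini_cpa_le (hs : ∀ x ∈ T.support, (T.inclusion X x).Subsingleton)
    (hdec : ∀ i, ∀ x ∈ T.simplex i, ⟪T.grad W i, X i x⟫ ≤ -(b * T.cpa W x)) {x v : E n}
    (hx : x ∈ interior T.support) (hv : v ∈ T.inclusion X x) :
    upperDini (fun h => T.cpa W (x + h • v)) ≤ ((-(b * T.cpa W x) : ℝ) : EReal) := by
  refine upperDini_le fun r hr => ?_
  filter_upwards [nhdsWithin_le_nhds (eventually_cpa_add_smul (W := W) hs hx hv),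
    self_mem_nhdsWithin] with h hh (h0 : 0 < h)
  obtain ⟨-, i, hi, he⟩ := hh
  rw [div_le_iff₀ h0, he, zero_smul, add_zero, add_sub_cancel_left, mul_comm]
  exact mul_le_mul_of_nonneg_right ((hdec i x hi).trans hr.le) h0.le

/-- In the interior of a sublevel set the level is not attained. -/
theorem cpa_lt_of_mem_interior (hs : ∀ x ∈ T.support, (T.inclusion X x).Subsingleton)
    (hdec : ∀ i, ∀ x ∈ T.simplex i, ⟪T.grad W i, X i x⟫ ≤ -(b * T.cpa W x)) (hb : 0 < b)
    {r : ℝ} (hr : 0 < r) {A : Set (E n)} (hA : A ⊆ T.support) (hAr : ∀ x ∈ A, T.cpa W x ≤ r)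
    {x : E n} (hx : x ∈ interior A) : T.cpa W x < r := by
  refine lt_of_le_of_ne (hAr x (interior_subset hx)) fun he => ?_
  obtain ⟨k, hk⟩ := T.mem_support.1 (hA (interior_subset hx))
  have hv : X k x ∈ T.inclusion X x := ⟨k, hk, rfl⟩
  have hc : Continuous fun h : ℝ => x + h • X k x := by fun_prop
  have h0 : Tendsto (fun h : ℝ => x + h • X k x) (𝓝 0) (𝓝 x) := by simpa using hc.tendsto 0
  have h1 : ∀ᶠ z in 𝓝 x, z ∈ A := mem_interior_iff_mem_nhds.1 hx
  have h2 := (h0.eventually h1).and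
    (eventually_cpa_add_smul (W := W) hs (interior_mono hA hx) hv)
  -- A short step backwards along the field would raise the value above `r` while staying in `A`.
  obtain ⟨h, ⟨hhA, -, i, hi, hhi⟩, hneg⟩ :=
    ((h2.filter_mono nhdsWithin_le_nhds).and (self_mem_nhdsWithin (s := Iio (0 : ℝ)))).exists
  have h3 := hAr _ hhA
  have h4 := hdec i x hi
  rw [hhi] at h3
  rw [he] at h3 h4
  have h5 : 0 < b * r := mul_pos hb hr
  have h6 : h < 0 := hneg
  nlinarith

theorem exists_selection (hs : ∀ x ∈ T.support, (T.inclusion X x).Subsingleton) :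
    ∃ g : E n → E n, ∀ i, EqOn g (X i) (T.simplex i) := by
  classical
  refine ⟨fun x => if h : ∃ i, x ∈ T.simplex i then X h.choose x else 0, fun i x hx => ?_⟩
  have h : ∃ i, x ∈ T.simplex i := ⟨i, hx⟩
  simp only [dif_pos h]
  exact hs x (T.mem_support.2 h) ⟨_, h.choose_spec, rfl⟩ ⟨i, hx, rfl⟩

/-- Forward existence in a sublevel set in the interior of the triangulation. -/
theorem hasGlobalSolution_sublevel (hX : ∀ i, ContDiff ℝ 1 (X i))
    (hs : ∀ x ∈ T.support, (T.inclusion X x).Subsingleton)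
    (hdec : ∀ i, ∀ x ∈ T.simplex i, ⟪T.grad W i, X i x⟫ ≤ -(b * T.cpa W x)) (hb : 0 < b)
    (h0 : ∀ x ∈ T.support, 0 ≤ T.cpa W x) {r : ℝ}
    (hr : {x ∈ T.support | T.cpa W x ≤ r} ⊆ interior T.support) (t₀ : ℝ) {x₀ : E n}
    (hx₀ : x₀ ∈ T.support) (hx₀r : T.cpa W x₀ ≤ r) :
    HasGlobalSolution (T.inclusion X) {x ∈ T.support | T.cpa W x ≤ r} t₀ x₀ := by
  have hXc : ∀ i, Continuous (X i) := fun i => (hX i).continuous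
  obtain ⟨g, hg⟩ := exists_selection hs
  have hgF : ∀ x ∈ T.support, g x ∈ T.inclusion X x := fun x hx => by
    obtain ⟨i, hi⟩ := T.mem_support.1 hx
    exact ⟨i, hi, hg i hi⟩
  obtain ⟨L, hL⟩ := T.exists_lipschitzOnWith_simplex X hX hg
  obtain ⟨M, hM⟩ := T.exists_norm_inclusion_le hXc
  have hK : IsCompact {x ∈ T.support | T.cpa W x ≤ r} := by
    have := (T.continuousOn_cpa W).preimage_isClosed_of_isClosed T.isCompact_support.isClosed
      (isClosed_Iic (a := r))
    exact T.isCompact_support.of_isClosed_subset this inter_subset_left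
  obtain ⟨ρ, hρ, hρK⟩ := hK.exists_cthickening_subset_open isOpen_interior hr
  have hball : ∀ x ∈ {x ∈ T.support | T.cpa W x ≤ r}, Metric.closedBall x ρ ⊆ T.support :=
    fun x hx => (Metric.closedBall_subset_cthickening hx ρ).trans (hρK.trans interior_subset)
  -- At speed at most `M` a solution cannot leave the ball of radius `ρ` within time `η`; the `+ 1`
  -- covers `M = 0`.
  set η : ℝ := ρ / (M + 1) with hηdef
  have hη : 0 < η := by positivity
  have hηM : M * η ≤ ρ := by
    rw [hηdef, mul_div_assoc', div_le_iff₀ (by positivity)]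
    nlinarith [M.2]
  refine hasGlobalSolution_of_uniform_step (M := M) hη (fun x hx => ?_) t₀ ⟨hx₀, hx₀r⟩
  lift ρ to ℝ≥0 using hρ.le
  obtain ⟨α, hα0, hα⟩ := exists_hasDerivWithinAt_mem_closedBall hη.le
    (lipschitzOnWith_of_convex_of_closed_cover T.isClosed_simplex hL (convex_closedBall x ρ)
      (hball x hx)) (fun z hz => hM z (hball x hx hz) _ (hgF z (hball x hx hz))) hηM
  have hmem : ∀ t ∈ Icc 0 η, α t ∈ T.support := fun t ht => hball x hx (hα t ht).1
  have hlip : LipschitzOnWith M α (Icc 0 η) :=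
    (convex_Icc 0 η).lipschitzOnWith_of_nnnorm_hasDerivWithin_le (fun t ht => (hα t ht).2)
      fun t ht => hM _ (hmem t ht) _ (hgF _ (hmem t ht))
  have hder : ∀ t ∈ Ioo 0 η, ∃ v ∈ T.inclusion X (α t), HasDerivAt α v t := fun t ht =>
    ⟨_, hgF _ (hmem t (Ioo_subset_Icc_self ht)),
      (hα t (Ioo_subset_Icc_self ht)).2.hasDerivAt (Icc_mem_nhds ht.1 ht.2)⟩
  have hsol : IsSolutionOn (T.inclusion X) T.support α 0 η :=
    ⟨hη.le, hmem, LipschitzOnWith.absolutelyContinuousOnInterval (uIcc_of_le hη.le ▸ hlip),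
      .of_forall hder⟩
  refine ⟨α, hα0, fun t ht => ⟨hmem t ht, ?_⟩, hlip, hder⟩
  refine (cpa_comp_le_mul_exp hXc hdec hsol ht).trans ?_
  rw [hα0, sub_zero]
  refine (mul_le_of_le_one_right (h0 x hx.1) (Real.exp_le_one_iff.2 ?_)).trans hx.2
  nlinarith [ht.1]

end Triangulation

theorem HasGlobalSolution.mono {n : ℕ} {F : E n → Set (E n)} {D D' : Set (E n)} {t₀ : ℝ}
    {x₀ : E n} (h : HasGlobalSolution F D t₀ x₀) (hD : D ⊆ D') : HasGlobalSolution F D' t₀ x₀ := by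
  obtain ⟨φ, h0, hφ⟩ := h
  exact ⟨φ, h0, fun t₁ h₁ => ⟨h₁, fun t ht => hD ((hφ t₁ h₁).mem t ht), (hφ t₁ h₁).absCont,
    (hφ t₁ h₁).deriv⟩⟩

/-! ### The closed loop of a feasible point -/

section ClosedLoop

variable {n m M p : ℕ} {S : System n m M} {T : Triangulation n} {mode : Fin T.card → Fin M}
  {H : Matrix (Fin p) (Fin m) ℝ} {hc : Fin p → ℝ} {y : Unknowns T m}

/-- The affine closed-loop vector field of the simplex `i` under the feedback with vertex values
`U`. -/
noncomputable def velocity (S : System n m M) (T : Triangulation n) (mode : Fin T.card → Fin M)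
    (U : T.vertices → E m) (i : Fin T.card) (x : E n) : E n :=
  S.drift (mode i) x + S.inputTerm (mode i) (T.affVec U i x)

theorem contDiff_velocity (U : T.vertices → E m) (i : Fin T.card) :
    ContDiff ℝ 1 (velocity S T mode U i) := by
  have h1 : ContDiff ℝ 1 fun x => (S.A (mode i)).toEuclideanLin x :=
    (LinearMap.toContinuousLinearMap (S.A (mode i)).toEuclideanLin).contDiff
  have h2 : ContDiff ℝ 1 fun x => (S.B (mode i)).toEuclideanLin x :=
    (LinearMap.toContinuousLinearMap (S.B (mode i)).toEuclideanLin).contDiff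
  exact (h1.add contDiff_const).add (h2.comp (T.contDiff_affVec U i))

theorem velocity_combo (U : T.vertices → E m) (i : Fin T.card) (x z : E n) {a b : ℝ}
    (hab : a + b = 1) :
    velocity S T mode U i (a • x + b • z) =
      a • velocity S T mode U i x + b • velocity S T mode U i z := by
  have hb : b = 1 - a := by linarith
  simp only [velocity, System.drift, System.inputTerm]
  rw [T.affVec_combo U i x z hab, map_add, map_add, map_smul, map_smul, map_smul, map_smul, hb]
  module

theorem closedLoop_eq_inclusion (hmode : S.Respects T mode) (U : T.vertices → E m) :
    S.closedLoop (T.cpaVec U) = T.inclusion (velocity S T mode U) := by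
  ext x v
  constructor
  · rintro ⟨s, hs, rfl⟩
    rw [hmode s] at hs
    obtain ⟨i, rfl, hi⟩ := mem_iUnion₂.1 hs
    exact ⟨i, hi, by rw [velocity, T.cpaVec_eq U hi]⟩
  · rintro ⟨i, hi, rfl⟩
    refine ⟨mode i, ?_, by rw [velocity, T.cpaVec_eq U hi]⟩
    rw [hmode (mode i)]
    exact mem_iUnion₂.2 ⟨i, rfl, hi⟩

/-- Both sides are affine in `x` on the simplex, so the points satisfying the inequality form a
convex set, which contains the vertices by the constraint. -/
theorem Feasible.inner_grad_velocity_le (hy : Feasible S T mode H hc y) (i : Fin T.card) {x : E n}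
    (hx : x ∈ T.simplex i) :
    ⟪T.grad y.V i, velocity S T mode y.U i x⟫ ≤ -(y.b₂ * T.cpa y.V x) := by
  rw [T.cpa_eq y.V hx]
  refine T.simplex_subset_of_convex
    (C := {x | ⟪T.grad y.V i, velocity S T mode y.U i x⟫ ≤ -(y.b₂ * T.affOn y.V i x)})
    ?_ (fun j => ?_) hx
  · intro x hx z hz a b ha hb hab
    simp only [mem_ofPred_eq] at hx hz ⊢
    rw [velocity_combo _ _ _ _ hab, T.affOn_combo _ _ _ _ hab, inner_add_right, inner_smul_right,
      inner_smul_right]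
    nlinarith [mul_le_mul_of_nonneg_left hx ha, mul_le_mul_of_nonneg_left hz hb]
  · rw [mem_ofPred_eq, T.affOn_vertex, velocity, T.affVec_vertex, inner_add_right,
      real_inner_comm, real_inner_comm (S.inputTerm _ _)]
    exact hy.decrease i j

theorem Feasible.V_pos (hy : Feasible S T mode H hc y) {v : T.vertices} (hv : v ≠ T.origin) :
    0 < y.V v := by
  have : 0 < ‖(v : E n)‖ := norm_pos_iff.2 fun h => hv (Subtype.ext h)
  exact (mul_pos hy.b₁_pos (Real.rpow_pos_of_pos this _)).trans_le (hy.lower v hv)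

theorem Feasible.mul_rpow_le (hy : Feasible S T mode H hc y) {x : E n} (hx : x ∈ T.support) :
    y.b₁ * ‖x‖ ^ y.a ≤ T.cpa y.V x := by
  have ha := hy.one_le_a
  refine T.le_cpa_of_convexOn (f := fun x => y.b₁ * ‖x‖ ^ y.a) ?_ (fun v => ?_) hx
  · refine ConvexOn.smul hy.b₁_pos.le ⟨convex_univ, fun x _ z _ a b h1 h2 hab => ?_⟩
    have h3 : ‖a • x + b • z‖ ≤ a * ‖x‖ + b * ‖z‖ :=
      (norm_add_le _ _).trans_eq (by rw [norm_smul_of_nonneg h1, norm_smul_of_nonneg h2])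
    exact (Real.rpow_le_rpow (norm_nonneg _) h3 (by linarith)).trans
      ((convexOn_rpow ha).2 (norm_nonneg x) (norm_nonneg z) h1 h2 hab)
  · by_cases hv : v = T.origin
    · subst hv
      have h0 : ‖((T.origin : T.vertices) : E n)‖ = 0 := norm_zero
      simp only [h0]
      rw [Real.zero_rpow (by linarith), mul_zero, hy.V_zero]
    · exact hy.lower v hv

theorem Feasible.cpa_nonneg (hy : Feasible S T mode H hc y) {x : E n} (hx : x ∈ T.support) :
    0 ≤ T.cpa y.V x :=
  (mul_nonneg hy.b₁_pos.le (Real.rpow_nonneg (norm_nonneg x) _)).trans (hy.mul_rpow_le hx)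

theorem Feasible.cpa_pos (hy : Feasible S T mode H hc y) {x : E n} (hx : x ∈ T.support)
    (h0 : x ≠ 0) : 0 < T.cpa y.V x :=
  (mul_pos hy.b₁_pos (Real.rpow_pos_of_pos (norm_pos_iff.2 h0) _)).trans_le (hy.mul_rpow_le hx)

theorem Feasible.norm_le_of_cpa_le (hy : Feasible S T mode H hc y) {x : E n} (hx : x ∈ T.support)
    {r s : ℝ} (hr : 0 < r) (h : T.cpa y.V x ≤ r * Real.exp (-(y.b₂ * s))) :
    ‖x‖ ≤ (r / y.b₁) ^ (1 / y.a) * Real.exp (-(y.b₂ / y.a) * s) := by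
  have ha : 0 < y.a := zero_lt_one.trans_le hy.one_le_a
  have hb := hy.b₁_pos
  rw [← Real.rpow_le_rpow_iff (norm_nonneg x) (by positivity) ha,
    Real.mul_rpow (by positivity) (by positivity), ← Real.rpow_mul (by positivity),
    one_div_mul_cancel ha.ne', Real.rpow_one, ← Real.exp_mul,
    show -(y.b₂ / y.a) * s * y.a = -(y.b₂ * s) by field_simp, div_mul_eq_mul_div,
    le_div_iff₀' hb]
  exact (hy.mul_rpow_le hx).trans h

theorem cpaVec_mem_polytope (hU : polytope H hc ∈ RegularSets m) (hy : Feasible S T mode H hc y)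
    {x : E n} (hx : x ∈ T.support) : T.cpaVec y.U x ∈ polytope H hc := by
  refine T.cpaVec_mem_of_convex ?_ (fun v => ?_) hx
  · intro w hw z hz a b ha hb hab l
    have hb' : b = 1 - a := by linarith
    have h1 := mul_le_mul_of_nonneg_left (hw l) ha
    have h2 := mul_le_mul_of_nonneg_left (hz l) hb
    rw [WithLp.ofLp_add, WithLp.ofLp_smul, WithLp.ofLp_smul, Matrix.mulVec_add, Matrix.mulVec_smul,
      Matrix.mulVec_smul, Pi.add_apply, Pi.smul_apply, Pi.smul_apply, smul_eq_mul, smul_eq_mul]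
    calc _ ≤ a * hc l + b * hc l := add_le_add h1 h2
      _ = hc l := by rw [← add_mul, hab, one_mul]
  · by_cases hv : v = T.origin
    · rw [hv, hy.U_zero]
      exact interior_subset hU.2.2.1
    · exact hy.input v hv

theorem isLyapunovFunction_cpa (hmode : S.Respects T mode) (hy : Feasible S T mode H hc y)
    (hb : 0 < y.b₂) :
    IsLyapunovFunction (S.closedLoop (T.cpaVec y.U)) T.support (T.cpa y.V) where
  zero_mem := T.zero_mem_interior_support
  continuousOn := T.continuousOn_cpa y.V
  map_zero := (T.cpa_vertex y.V T.origin).trans hy.V_zero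
  pos _ hx h0 := hy.cpa_pos hx h0
  decrease φ t₀ t₁ hφ t ht h0 := by
    rw [closedLoop_eq_inclusion hmode] at hφ
    refine (Triangulation.upperDini_cpa_comp_le (fun i => (contDiff_velocity y.U i).continuous)
      (fun i x hx => hy.inner_grad_velocity_le i hx) hφ ht).trans_lt ?_
    have := mul_pos hb (hy.cpa_pos (hφ.mem t (Ico_subset_Icc_self ht)) h0)
    exact_mod_cast neg_neg_of_pos this

theorem closedLoop_zero (he : ∀ s, (0 : E n) ∈ S.R s → S.e s = 0) (hmode : S.Respects T mode)
    {U : T.vertices → E m} (hU : U T.origin = 0) : S.closedLoop (T.cpaVec U) 0 = {0} := by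
  have hu : T.cpaVec U 0 = 0 := (T.cpaVec_vertex U T.origin).trans hU
  have key : ∀ s, (0 : E n) ∈ S.R s → S.drift s 0 + S.inputTerm s (T.cpaVec U 0) = 0 := by
    intro s hs
    simp [System.drift, System.inputTerm, hu, he s hs]
  ext v
  constructor
  · rintro ⟨s, hs, rfl⟩
    exact key s hs
  · rintro rfl
    obtain ⟨i, hi⟩ := T.mem_support.1 (interior_subset T.zero_mem_interior_support)
    have hs : (0 : E n) ∈ S.R (mode i) := by
      rw [hmode (mode i)]
      exact mem_iUnion₂.2 ⟨i, rfl, hi⟩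
    exact ⟨mode i, hs, (key _ hs).symm⟩

theorem isLocallyExponentiallyStable_closedLoop (he : ∀ s, (0 : E n) ∈ S.R s → S.e s = 0)
    (hmode : S.Respects T mode) (hy : Feasible S T mode H hc y) (hb : 0 < y.b₂) :
    IsLocallyExponentiallyStable (S.closedLoop (T.cpaVec y.U)) T.support := by
  obtain ⟨c, hc0, hcV⟩ := T.exists_norm_le y.V (fun v hv => hy.V_pos hv) hy.V_zero
  obtain ⟨δ, L, hδ, hL, hball, hLV⟩ := T.exists_le_norm y.V hy.V_zero
  refine ⟨closedLoop_zero he hmode hy.U_zero, δ, L / c, y.b₂, hδ, by positivity, hb, hball,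
    fun φ t₀ t₁ hφ h0 t ht => ?_⟩
  rw [closedLoop_eq_inclusion hmode] at hφ
  have h1 := Triangulation.cpa_comp_le_mul_exp
    (fun i => (contDiff_velocity y.U i).continuous)
    (fun i x hx => hy.inner_grad_velocity_le i hx) hφ ht
  have h2 := hcV _ (hφ.mem t ht)
  have h3 := mul_le_mul_of_nonneg_right (hLV _ h0) (Real.exp_pos (-(y.b₂ * (t - t₀)))).le
  rw [neg_mul, div_mul_eq_mul_div, div_mul_eq_mul_div, le_div_iff₀' hc0]
  exact h2.trans (h1.trans h3)

theorem mem_sublevel_and_norm_le (hmode : S.Respects T mode) (hy : Feasible S T mode H hc y)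
    (hb : 0 < y.b₂) {r : ℝ} (hr : 0 < r) {φ : ℝ → E n} {t₀ t₁ : ℝ}
    (hφ : IsSolutionOn (S.closedLoop (T.cpaVec y.U)) T.support φ t₀ t₁)
    (h0 : T.cpa y.V (φ t₀) ≤ r) {t : ℝ} (ht : t ∈ Icc t₀ t₁) :
    φ t ∈ {x ∈ T.support | T.cpa y.V x ∈ Icc 0 r} ∧
      ‖φ t‖ ≤ (r / y.b₁) ^ (1 / y.a) * Real.exp (-(y.b₂ / y.a) * (t - t₀)) := by
  rw [closedLoop_eq_inclusion hmode] at hφ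
  have h1 := Triangulation.cpa_comp_le_mul_exp
    (fun i => (contDiff_velocity y.U i).continuous)
    (fun i x hx => hy.inner_grad_velocity_le i hx) hφ ht
  have hmem := hφ.mem t ht
  have h2 := h1.trans (mul_le_mul_of_nonneg_right h0 (Real.exp_pos _).le)
  refine ⟨⟨hmem, hy.cpa_nonneg hmem, h2.trans (mul_le_of_le_one_right hr.le ?_)⟩,
    hy.norm_le_of_cpa_le hmem hr h2⟩
  exact Real.exp_le_one_iff.2 (by nlinarith [ht.1])

theorem exists_hasGlobalSolution_near_zero (hmode : S.Respects T mode)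
    (hy : Feasible S T mode H hc y) (hb : 0 < y.b₂)
    (hs : ∀ x ∈ T.support, (S.closedLoop (T.cpaVec y.U) x).Subsingleton) :
    ∃ δ : ℝ, 0 < δ ∧ ∀ t₀ x₀, ‖x₀‖ < δ →
      HasGlobalSolution (S.closedLoop (T.cpaVec y.U)) T.support t₀ x₀ := by
  rw [closedLoop_eq_inclusion hmode] at hs ⊢
  obtain ⟨c, hc0, hcV⟩ := T.exists_norm_le y.V (fun v hv => hy.V_pos hv) hy.V_zero
  obtain ⟨δ, L, hδ, hL, hball, hLV⟩ := T.exists_le_norm y.V hy.V_zero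
  -- Then `V x₀ ≤ L * ‖x₀‖ < c * (δ / 2)`, and the sublevel set at this value lies in the closed
  -- ball of radius `δ / 2`, inside the interior of `T`.
  refine ⟨min δ (c * (δ / 2) / L), by positivity, fun t₀ x₀ h0 => ?_⟩
  obtain ⟨h1, h2⟩ := lt_min_iff.1 h0
  rw [lt_div_iff₀' hL] at h2
  refine (Triangulation.hasGlobalSolution_sublevel (r := c * (δ / 2))
    (fun i => contDiff_velocity y.U i) hs (fun i x hx => hy.inner_grad_velocity_le i hx) hb
    (fun x hx => hy.cpa_nonneg hx) (fun x hx => ?_) t₀ (hball (by simpa using h1))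
    ((hLV x₀ h1).trans h2.le)).mono fun x hx => hx.1
  have h3 : ‖x‖ ≤ δ / 2 := le_of_mul_le_mul_left ((hcV x hx.1).trans hx.2) hc0
  exact interior_maximal hball Metric.isOpen_ball (by simpa using h3.trans_lt (half_lt_self hδ))

theorem hasGlobalSolution_of_le_frontier (hmode : S.Respects T mode)
    (hy : Feasible S T mode H hc y) (hb : 0 < y.b₂)
    (hs : ∀ x ∈ T.support, (S.closedLoop (T.cpaVec y.U) x).Subsingleton) {r : ℝ} (hr : 0 < r)
    (hfr : ∀ x ∈ frontier T.support, r ≤ T.cpa y.V x) (t₀ : ℝ) {x₀ : E n}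
    (hx₀ : x₀ ∈ interior {x ∈ T.support | T.cpa y.V x ∈ Icc 0 r}) :
    HasGlobalSolution (S.closedLoop (T.cpaVec y.U)) {x ∈ T.support | T.cpa y.V x ∈ Icc 0 r}
      t₀ x₀ := by
  rw [closedLoop_eq_inclusion hmode] at hs ⊢
  have hdec : ∀ i, ∀ x ∈ T.simplex i,
      ⟪T.grad y.V i, velocity S T mode y.U i x⟫ ≤ -(y.b₂ * T.cpa y.V x) :=
    fun i x hx => hy.inner_grad_velocity_le i hx
  have hlt : T.cpa y.V x₀ < r := Triangulation.cpa_lt_of_mem_interior hs hdec hb hr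
    (fun x hx => hx.1) (fun x hx => hx.2.2) hx₀
  -- The level `V x₀` is strictly below `r`, so its sublevel set avoids the frontier of `T`, which
  -- the set at level `r` may touch.
  refine (Triangulation.hasGlobalSolution_sublevel (r := T.cpa y.V x₀)
    (fun i => contDiff_velocity y.U i) hs hdec hb (fun x hx => hy.cpa_nonneg hx)
    (fun x hx => ?_) t₀ (interior_subset hx₀).1 le_rfl).mono
    fun x hx => ⟨hx.1, hy.cpa_nonneg hx.1, hx.2.trans hlt.le⟩
  by_contra hni
  have : x ∈ frontier T.support := by
    rw [T.isCompact_support.isClosed.frontier_eq]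
    exact ⟨hx.1, hni⟩
  exact absurd (hfr x this) (not_le.2 (hx.2.trans_lt hlt))

end ClosedLoop

end PWA

theorem theorem2 {n m M p : ℕ}
    -- the constrained piecewise affine system
    (S : PWA.System n m M) (X Ω : Set (PWA.E n))
    (hX : X ∈ PWA.RegularSets n) (hΩ : Ω ∈ PWA.RegularSets n) (hΩX : Ω ⊆ X)
    (H : Matrix (Fin p) (Fin m) ℝ) (hc : Fin p → ℝ)
    (hU : PWA.polytope H hc ∈ PWA.RegularSets m)
    (hpart : S.IsPartition Ω)
    (he : ∀ s, (0 : PWA.E n) ∈ S.R s → S.e s = 0)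
    -- the triangulation
    (T : PWA.Triangulation n) (hT : T.support = Ω)
    (mode : Fin T.card → Fin M) (hmode : S.Respects T mode)
    -- an optimum of the program, with positive `b₂`
    (J : PWA.Unknowns T m → ℝ) (y : PWA.Unknowns T m)
    (hy : PWA.IsOptimum S T mode H hc J y) (hb₂ : 0 < y.b₂)
    -- the CPA functions of the optimum and the closed loop
    (V : PWA.E n → ℝ) (hV : V = T.cpa y.V)
    (u : PWA.E n → PWA.E m) (hu : u = T.cpaVec y.U)
    (F : PWA.E n → Set (PWA.E n)) (hF : F = S.closedLoop u) :
    -- the controller is admissible and `V` is a Lyapunov function with decay rate `b₂`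
    (∀ x ∈ T.support, u x ∈ PWA.polytope H hc) ∧
    PWA.IsLyapunovFunction F T.support V ∧
    (∀ x ∈ T.support, y.b₁ * ‖x‖ ^ y.a ≤ V x) ∧
    (∀ φ t₀ t₁, PWA.IsSolutionOn F T.support φ t₀ t₁ → ∀ t ∈ Set.Ico t₀ t₁,
      PWA.upperDini (fun h => V (φ (t + h))) ≤ ((-(y.b₂ * V (φ t)) : ℝ) : EReal)) ∧
    -- local exponential stability
    PWA.IsLocallyExponentiallyStable F T.support ∧
    -- the explicit bound on the sublevel sets, and their positive invariance
    (∀ (r : ℝ) (A : Set (PWA.E n)), 0 < r → A = {x ∈ T.support | V x ∈ Set.Icc 0 r} →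
      A ∈ PWA.RegularSets n →
      ∀ φ t₀ t₁, PWA.IsSolutionOn F T.support φ t₀ t₁ → φ t₀ ∈ interior A →
        ∀ t ∈ Set.Icc t₀ t₁, φ t ∈ A ∧
          ‖φ t‖ ≤ (r / y.b₁) ^ (1 / y.a) * Real.exp (-(y.b₂ / y.a) * (t - t₀))) ∧
    -- if the closed-loop vector field is single-valued (hence continuous) on `T`:
    ((∀ x ∈ T.support, (F x).Subsingleton) →
      -- the pointwise Dini derivative of `V` along the vector field
      (∀ x ∈ interior T.support, ∀ v ∈ F x,
        PWA.upperDini (fun h => V (x + h • v)) ≤ ((-(y.b₂ * V x) : ℝ) : EReal)) ∧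
      -- solutions from near the origin exist for all future times
      (∃ δ : ℝ, 0 < δ ∧ ∀ t₀ x₀, ‖x₀‖ < δ → PWA.HasGlobalSolution F T.support t₀ x₀) ∧
      -- and so do those from a sublevel set that does not run out of `T`
      (∀ (r : ℝ) (A : Set (PWA.E n)), 0 < r → A = {x ∈ T.support | V x ∈ Set.Icc 0 r} →
        A ∈ PWA.RegularSets n → (∀ x ∈ frontier T.support, r ≤ V x) →
        ∀ t₀, ∀ x₀ ∈ interior A, PWA.HasGlobalSolution F A t₀ x₀)) := by
  subst hV hu hF
  have hy := hy.1
  have hvel : ∀ i, ContDiff ℝ 1 (PWA.velocity S T mode y.U i) := fun i =>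
    PWA.contDiff_velocity y.U i
  have hvelc := fun i => (hvel i).continuous
  have hdec : ∀ i, ∀ x ∈ T.simplex i,
      ⟪T.grad y.V i, PWA.velocity S T mode y.U i x⟫ ≤ -(y.b₂ * T.cpa y.V x) :=
    fun i x hx => hy.inner_grad_velocity_le i hx
  refine ⟨fun x hx => PWA.cpaVec_mem_polytope hU hy hx,
    PWA.isLyapunovFunction_cpa hmode hy hb₂, fun x hx => hy.mul_rpow_le hx,
    fun φ t₀ t₁ hφ t ht => ?_, PWA.isLocallyExponentiallyStable_closedLoop he hmode hy hb₂,
    ?_, fun hs => ⟨fun x hx v hv => ?_,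
      PWA.exists_hasGlobalSolution_near_zero hmode hy hb₂ hs, ?_⟩⟩
  · rw [PWA.closedLoop_eq_inclusion hmode] at hφ
    exact PWA.Triangulation.upperDini_cpa_comp_le hvelc hdec hφ ht
  · rintro r A hr rfl - φ t₀ t₁ hφ h0 t ht
    exact PWA.mem_sublevel_and_norm_le hmode hy hb₂ hr hφ (interior_subset h0).2.2 ht
  · rw [PWA.closedLoop_eq_inclusion hmode] at hs hv
    exact PWA.Triangulation.upperDini_cpa_le hs hdec hx hv
  · rintro r A hr rfl - hfr t₀ x₀ hx₀
    exact PWA.hasGlobalSolution_of_le_frontier hmode hy hb₂ hs hr hfr t₀ hx₀
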